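/- Let $n\ge 1$ be an integer and let $\mathcal H^t$ denote $t$-dimensional Hausdorff measure on $\mathbb R^n$ with the Euclidean metric. For $F\subset\mathbb R^n$ and $\delta\ge 0$ write $\Delta(F,\delta)=\{x\in\mathbb R^n: \operatorname{dist}(x,F)<\delta\}$ (with $\Delta(\emptyset,\delta)=\emptyset$). Let $0\le\kappa<1$ and let $(F_j)_{j\in\mathbb N}$ be a sequence of subsets of $\mathbb R^n$ satisfying the local scaling property with respect to $\kappa$: there exist constants $c_3,c_4,r_1>0$ such that, for all $0<r<r_1$, $0\le\delta<r$, $j\in\mathbb N$ and $x\in F_j$, $$c_3\,\delta^{\,n-\kappa n}\,r^{\kappa n}\;\le\;\mathcal H^n\big(B(x,r)\cap\Delta(F_j,\delta)\big)\;\le\; c_4\,\delta^{\,n-\kappa n}\,r^{\kappa n},$$ where $B(x,r)$ is the ball with centre $x$ and radius $r$. For a sequence $\Upsilon=(\Upsilon_j)_{j\in\mathbb N}$ of non-negative reals put $$\Lambda(\Upsilon)=\{x\in\mathbb R^n : x\in\Delta(F_j,\Upsilon_j)\text{ for infinitely many } j\in\mathbb N\},$$ and, for $a>0$, write $\Upsilon^a=(\Upsilon_j^a)_{j\in\mathbb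 N}$. Let $\Upsilon=(\Upsilon_j)_{j\in\mathbb N}$ be a sequence of non-negative reals with $\Upsilon_j\to0$ as $j\to\infty$, let $s>\kappa n$, and suppose that for every ball $B$ in $\mathbb R^n$ $$\mathcal H^n\Big(B\cap\Lambda\big(\Upsilon^{\frac{s-\kappa n}{(1-\kappa)n}}\big)\Big)=\mathcal H^n(B).$$ Then, for every ball $B$ in $\mathbb R^n$, $$\mathcal H^s\big(B\cap\Lambda(\Upsilon)\big)=\mathcal H^s(B).$$ -/

import Mathlib

open MeasureTheory

/-- The `δ`-neighbourhood `Δ(F, δ) = {x : d(x, F) < δ}` of a set `F` in a metric space. It is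
empty if `F` is empty (the distance to the empty set is `∞`) or if `δ ≤ 0`. -/
def nbhd {X : Type*} [MetricSpace X] (F : Set X) (δ : ℝ) : Set X :=
  {x | Metric.infEDist x F < ENNReal.ofReal δ}

/-- The limsup set `Λ(Υ)` of a sequence of sets `F` and a sequence of reals `Υ`: the points that
lie in `Δ(F j, Υ j)` for infinitely many `j`. -/
def limsupNbhd {X : Type*} [MetricSpace X] (F : ℕ → Set X) (Υ : ℕ → ℝ) : Set X :=
  {x | {j : ℕ | x ∈ nbhd (F j) (Υ j)}.Infinite}

/-- The local scaling property with respect to `κ` of a sequence of subsets of `ℝⁿ`: there are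
constants `c₃, c₄, r₁ > 0` such that, for all `0 < r < r₁`, `0 ≤ δ < r`, all `j` and all `x ∈ F j`,
`c₃ δ^(n - κn) r^(κn) ≤ ℋⁿ(B(x, r) ∩ Δ(F j, δ)) ≤ c₄ δ^(n - κn) r^(κn)`. -/
def LocalScaling {n : ℕ} (F : ℕ → Set (EuclideanSpace ℝ (Fin n))) (κ : ℝ) : Prop :=
  ∃ c₃ c₄ r₁ : ℝ, 0 < c₃ ∧ 0 < c₄ ∧ 0 < r₁ ∧
    ∀ r δ : ℝ, 0 < r → r < r₁ → 0 ≤ δ → δ < r → ∀ j : ℕ, ∀ x ∈ F j,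
      ENNReal.ofReal (c₃ * δ ^ ((n : ℝ) - κ * n) * r ^ (κ * n))
          ≤ Measure.hausdorffMeasure (n : ℝ) (Metric.ball x r ∩ nbhd (F j) δ) ∧
      Measure.hausdorffMeasure (n : ℝ) (Metric.ball x r ∩ nbhd (F j) δ)
          ≤ ENNReal.ofReal (c₄ * δ ^ ((n : ℝ) - κ * n) * r ^ (κ * n))

/-! The case `s = n` is the hypothesis itself (the exponent is 1), and for `s > n` both sides
vanish. For `s < n` both sides are infinite, for two reasons.

Analytic part (`measure_le_tsum_of_cover`): the exponent `a = (s - κn)/((1 - κ)n)` is the one for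
which `Δ(F j, Υ j)` inside a ball of radius `ρ = Υ j ^ a` centred on `F j`, with density `Υ j ^ (s -
n)`, has mass comparable to `ρ ^ n`. Vitali's lemma turns the full measure of `Λ(Υ ^ a)` into
disjoint balls of this kind filling a fixed proportion of any open `V`. Together they carry a mass
at least comparable to the measure of `V`, and a ball of small radius `r` receives at most a
constant times `r ^ s`. By the mass distribution principle, covering `E k ∩ V`, where `E k = ⋃ j ≥
k, Δ(F j, Υ j)`, costs at least a fixed multiple of the volume of `V`.

Geometric part: since this bound holds in every open `V`, its constant can be removed
(`HasVolumeContentBound.not_subset`), so each `E k` has full dyadic content in each small cube. A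
nested-cube argument in the spirit of Baire passes this to `⋂ k, E k = Λ(Υ)`
(`exists_mem_iInter_notMem_dyadicCube`). Full `s`-content in all small cubes with `s < n` forces
infinite `ℋˢ` measure (`hausdorffMeasure_inter_dyadicCube_eq_top`). -/

/-! ### Dyadic cubes: nesting, volume and diameter. -/

section Dyadic

open Set Filter Topology
open scoped ENNReal

variable {n : ℕ}

/-- The integer coordinates of the dyadic cube of side `2⁻ᵐ` that contains `x`. -/
noncomputable def dyadicIndex (m : ℕ) (x : EuclideanSpace ℝ (Fin n)) : Fin n → ℤ :=
  fun i => ⌊(2 : ℝ) ^ m * x i⌋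

/-- The half-open dyadic cube with level `q.1` and integer coordinates `q.2`. -/
def dyadicCube (q : ℕ × (Fin n → ℤ)) : Set (EuclideanSpace ℝ (Fin n)) :=
  {x | dyadicIndex q.1 x = q.2}

/-- The interior of a dyadic cube. -/
def dyadicOpenCube (q : ℕ × (Fin n → ℤ)) : Set (EuclideanSpace ℝ (Fin n)) :=
  {x | ∀ i, x i ∈ Ioo ((q.2 i : ℝ) / 2 ^ q.1) (((q.2 i : ℝ) + 1) / 2 ^ q.1)}

/-- The closure of a dyadic cube. -/
def dyadicClosedCube (q : ℕ × (Fin n → ℤ)) : Set (EuclideanSpace ℝ (Fin n)) :=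
  {x | ∀ i, x i ∈ Icc ((q.2 i : ℝ) / 2 ^ q.1) (((q.2 i : ℝ) + 1) / 2 ^ q.1)}

/-- The `s`-th power of the side of a dyadic cube. -/
noncomputable def dyadicCost (s : ℝ) (q : ℕ × (Fin n → ℤ)) : ℝ≥0∞ :=
  ENNReal.ofReal (((1 / 2 : ℝ) ^ q.1) ^ s)

/-- The dyadic cube `p` is a descendant of the dyadic cube `q` (or equal to it). -/
def DyadicLE (p q : ℕ × (Fin n → ℤ)) : Prop :=
  q.1 ≤ p.1 ∧ dyadicCube p ⊆ dyadicCube q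

theorem mem_dyadicCube_index (m : ℕ) (x : EuclideanSpace ℝ (Fin n)) :
    x ∈ dyadicCube (m, dyadicIndex m x) := rfl

theorem mem_dyadicCube_iff {q : ℕ × (Fin n → ℤ)} {x : EuclideanSpace ℝ (Fin n)} :
    x ∈ dyadicCube q ↔
      ∀ i, x i ∈ Ico ((q.2 i : ℝ) / 2 ^ q.1) (((q.2 i : ℝ) + 1) / 2 ^ q.1) := by
  have h2 : (0 : ℝ) < 2 ^ q.1 := by positivity
  simp only [dyadicCube, dyadicIndex, mem_ofPred_eq, funext_iff, Int.floor_eq_iff, mem_Ico,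
    div_le_iff₀ h2, lt_div_iff₀ h2, mul_comm]

theorem dyadicOpenCube_subset (q : ℕ × (Fin n → ℤ)) : dyadicOpenCube q ⊆ dyadicCube q :=
  fun _ hx => mem_dyadicCube_iff.2 fun i => Ioo_subset_Ico_self (hx i)

theorem dyadicCube_subset_closedCube (q : ℕ × (Fin n → ℤ)) :
    dyadicCube q ⊆ dyadicClosedCube q :=
  fun _ hx i => Ico_subset_Icc_self (mem_dyadicCube_iff.1 hx i)

theorem isOpen_dyadicOpenCube (q : ℕ × (Fin n → ℤ)) : IsOpen (dyadicOpenCube q) := by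
  simp only [dyadicOpenCube, ofPred_forall]
  exact isOpen_iInter_of_finite fun i => isOpen_Ioo.preimage (by fun_prop)

theorem isClosed_dyadicClosedCube (q : ℕ × (Fin n → ℤ)) : IsClosed (dyadicClosedCube q) := by
  simp only [dyadicClosedCube, ofPred_forall]
  exact isClosed_iInter fun i => isClosed_Icc.preimage (by fun_prop)

theorem measurableSet_dyadicCube (q : ℕ × (Fin n → ℤ)) : MeasurableSet (dyadicCube q) := by
  have : dyadicCube q = ⋂ i, (fun x : EuclideanSpace ℝ (Fin n) => x i) ⁻¹'
      Ico ((q.2 i : ℝ) / 2 ^ q.1) (((q.2 i : ℝ) + 1) / 2 ^ q.1) := by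
    ext x; simp [mem_dyadicCube_iff]
  rw [this]
  exact MeasurableSet.iInter fun i => measurableSet_Ico.preimage (by fun_prop)

theorem volume_dyadicOpenCube (q : ℕ × (Fin n → ℤ)) :
    volume (dyadicOpenCube q) = ENNReal.ofReal ((1 / 2 : ℝ) ^ q.1) ^ n := by
  have : dyadicOpenCube q = (WithLp.ofLp : EuclideanSpace ℝ (Fin n) → Fin n → ℝ) ⁻¹'
      (pi univ fun i => Ioo ((q.2 i : ℝ) / 2 ^ q.1) (((q.2 i : ℝ) + 1) / 2 ^ q.1)) := by
    ext x; simp [dyadicOpenCube]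
  rw [this, (PiLp.volume_preserving_ofLp (Fin n)).measure_preimage
    (MeasurableSet.univ_pi fun i => measurableSet_Ioo).nullMeasurableSet, Real.volume_pi_Ioo]
  simp [← sub_div]

theorem volume_dyadicClosedCube (q : ℕ × (Fin n → ℤ)) :
    volume (dyadicClosedCube q) = ENNReal.ofReal ((1 / 2 : ℝ) ^ q.1) ^ n := by
  have : dyadicClosedCube q = (WithLp.ofLp : EuclideanSpace ℝ (Fin n) → Fin n → ℝ) ⁻¹'
      (pi univ fun i => Icc ((q.2 i : ℝ) / 2 ^ q.1) (((q.2 i : ℝ) + 1) / 2 ^ q.1)) := by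
    ext x; simp [dyadicClosedCube, forall_and, Pi.le_def]
  rw [this, (PiLp.volume_preserving_ofLp (Fin n)).measure_preimage
    (MeasurableSet.univ_pi fun i => measurableSet_Icc).nullMeasurableSet, pi_univ_Icc,
    Real.volume_Icc_pi]
  simp [← sub_div]

theorem dyadicIndex_eq_of_le {m m' : ℕ} (h : m ≤ m') {x y : EuclideanSpace ℝ (Fin n)}
    (hxy : dyadicIndex m' x = dyadicIndex m' y) : dyadicIndex m x = dyadicIndex m y := by
  have key : ∀ (z : EuclideanSpace ℝ (Fin n)) (i : Fin n),
      dyadicIndex m z i = dyadicIndex m' z i / ((2 ^ (m' - m) : ℕ) : ℤ) := by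
    intro z i
    rw [dyadicIndex, dyadicIndex, ← Int.floor_div_natCast]
    congr 1
    have : (2 : ℝ) ^ m' = 2 ^ m * 2 ^ (m' - m) := by rw [← pow_add]; congr 1; omega
    rw [this]; push_cast; field_simp
  funext i
  rw [key, key, hxy]

theorem DyadicLE.of_mem {p q : ℕ × (Fin n → ℤ)} (h : q.1 ≤ p.1)
    {x : EuclideanSpace ℝ (Fin n)} (hp : x ∈ dyadicCube p) (hq : x ∈ dyadicCube q) :
    DyadicLE p q := by
  refine ⟨h, fun y hy => ?_⟩
  have : dyadicIndex p.1 y = dyadicIndex p.1 x := Eq.trans hy (Eq.symm hp)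
  exact (dyadicIndex_eq_of_le h this).trans hq

theorem dyadic_eq_of_mem {p q : ℕ × (Fin n → ℤ)} (h : q.1 = p.1)
    {x : EuclideanSpace ℝ (Fin n)} (hp : x ∈ dyadicCube p) (hq : x ∈ dyadicCube q) : p = q := by
  refine Prod.ext h.symm ?_
  have hp' : dyadicIndex p.1 x = p.2 := hp
  have hq' : dyadicIndex q.1 x = q.2 := hq
  rw [← hp', ← hq', h]

theorem mk_dyadicIndex_of_mem {p : ℕ × (Fin n → ℤ)} {x : EuclideanSpace ℝ (Fin n)}
    (hx : x ∈ dyadicCube p) : (p.1, dyadicIndex p.1 x) = p := Prod.ext rfl hx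

theorem DyadicLE.trans {p q r : ℕ × (Fin n → ℤ)} (h : DyadicLE p q) (h' : DyadicLE q r) :
    DyadicLE p r := ⟨h'.1.trans h.1, h.2.trans h'.2⟩

theorem DyadicLE.cost_le {s : ℝ} (hs : 0 ≤ s) {p q : ℕ × (Fin n → ℤ)} (h : DyadicLE p q) :
    dyadicCost s p ≤ dyadicCost s q :=
  ENNReal.ofReal_le_ofReal (Real.rpow_le_rpow (by positivity)
    (pow_le_pow_of_le_one (by norm_num) (by norm_num) h.1) hs)

theorem nonempty_dyadicCube (q : ℕ × (Fin n → ℤ)) : (dyadicCube q).Nonempty := by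
  refine ⟨WithLp.toLp 2 fun i => (q.2 i : ℝ) / 2 ^ q.1, mem_dyadicCube_iff.2 fun i => ?_⟩
  simp only [mem_Ico, le_refl, true_and]
  gcongr; simp

theorem dist_le_of_mem_dyadicClosedCube {q : ℕ × (Fin n → ℤ)} {x y : EuclideanSpace ℝ (Fin n)}
    (hx : x ∈ dyadicClosedCube q) (hy : y ∈ dyadicClosedCube q) :
    dist x y ≤ √n * (1 / 2 : ℝ) ^ q.1 := by
  have h : ∀ i, dist (x i) (y i) ≤ (1 / 2 : ℝ) ^ q.1 := fun i => by
    refine (Real.dist_le_of_mem_Icc (hx i) (hy i)).trans_eq ?_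
    rw [← sub_div]; simp
  rw [EuclideanSpace.dist_eq]
  calc √(∑ i, dist (x i) (y i) ^ 2) ≤ √(∑ _i : Fin n, ((1 / 2 : ℝ) ^ q.1) ^ 2) := by
        gcongr with i; exact h i
    _ = √n * (1 / 2 : ℝ) ^ q.1 := by
        simp only [Finset.sum_const, Finset.card_univ, Fintype.card_fin, nsmul_eq_mul]
        rw [Real.sqrt_mul (by positivity), Real.sqrt_sq (by positivity)]

theorem exists_dyadicClosedCube_subset {U : Set (EuclideanSpace ℝ (Fin n))} (hU : IsOpen U)
    {x : EuclideanSpace ℝ (Fin n)} (hx : x ∈ U) :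
    ∃ m₀ : ℕ, ∀ m ≥ m₀, dyadicClosedCube (m, dyadicIndex m x) ⊆ U := by
  obtain ⟨ε, hε, hball⟩ := Metric.isOpen_iff.1 hU x hx
  have hlim : Tendsto (fun m : ℕ => √n * (1 / 2 : ℝ) ^ m) atTop (𝓝 (√n * 0)) :=
    (tendsto_pow_atTop_nhds_zero_of_lt_one (by norm_num) (by norm_num)).const_mul _
  rw [mul_zero] at hlim
  obtain ⟨m₀, hm₀⟩ := eventually_atTop.1 (hlim.eventually (gt_mem_nhds hε))
  refine ⟨m₀, fun m hm y hy => hball ?_⟩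
  exact (dist_le_of_mem_dyadicClosedCube hy
    (dyadicCube_subset_closedCube _ (mem_dyadicCube_index m x))).trans_lt (hm₀ m hm)

end Dyadic
-- Full dyadic content of countable intersections of open sets.
section Content

open Set Filter Topology
open scoped ENNReal

variable {n : ℕ}

/-- The total cost of the members of the family `P` of dyadic cubes that descend from `q`. -/
noncomputable def dyadicWeight (s : ℝ) (P : ℕ → ℕ × (Fin n → ℤ)) (q : ℕ × (Fin n → ℤ)) : ℝ≥0∞ :=
  ∑' l, {l | DyadicLE (P l) q}.indicator (fun l => dyadicCost s (P l)) l

/-- The relatively open pieces `E ∩ V` of `E` cannot be covered by dyadic cubes of total cost much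
less than the volume of `V`. -/
def HasVolumeContentBound (s : ℝ) (m₀ : ℕ) (E : Set (EuclideanSpace ℝ (Fin n))) : Prop :=
  ∃ C : ℝ≥0∞, C ≠ ∞ ∧ ∀ V : Set (EuclideanSpace ℝ (Fin n)), IsOpen V →
    ∀ T : Set (ℕ × (Fin n → ℤ)), (∀ q ∈ T, m₀ ≤ q.1) → E ∩ V ⊆ ⋃ q ∈ T, dyadicCube q →
      volume V ≤ C * ∑' q : T, dyadicCost s q.1

theorem dyadicCost_pos (s : ℝ) (q : ℕ × (Fin n → ℤ)) : 0 < dyadicCost s q :=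
  ENNReal.ofReal_pos.2 (by positivity)

theorem volume_closed_eq_cost (q : ℕ × (Fin n → ℤ)) :
    volume (dyadicClosedCube q) = dyadicCost n q := by
  rw [volume_dyadicClosedCube, dyadicCost, ← ENNReal.ofReal_pow (by positivity), Real.rpow_natCast]

theorem volume_open_eq_cost (q : ℕ × (Fin n → ℤ)) :
    volume (dyadicOpenCube q) = dyadicCost n q := by
  rw [volume_dyadicOpenCube, dyadicCost, ← ENNReal.ofReal_pow (by positivity), Real.rpow_natCast]

theorem dyadicCost_mul (s t : ℝ) (q : ℕ × (Fin n → ℤ)) :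
    dyadicCost s q * dyadicCost t q = dyadicCost (s + t) q := by
  rw [dyadicCost, dyadicCost, dyadicCost, ← ENNReal.ofReal_mul (by positivity),
    ← Real.rpow_add (by positivity)]

/-- Raising the exponent from `s` to `n` multiplies each cost by side `^ (n - s)`, a factor that is
largest for `Q` itself. -/
theorem tsum_dyadicCost_dim_lt {s : ℝ} (hsn : s ≤ n) {Q : ℕ × (Fin n → ℤ)}
    {T : Set (ℕ × (Fin n → ℤ))} (hT : ∀ q ∈ T, DyadicLE q Q)
    (hcost : ∑' q : T, dyadicCost s q.1 < dyadicCost s Q) :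
    ∑' q : T, dyadicCost (n : ℝ) q.1 < dyadicCost (n : ℝ) Q := by
  have hsplit : ∀ q : ℕ × (Fin n → ℤ),
      dyadicCost (n : ℝ) q = dyadicCost s q * dyadicCost (n - s) q := fun q => by
    rw [dyadicCost_mul, add_sub_cancel]
  calc ∑' q : T, dyadicCost (n : ℝ) q.1
      ≤ ∑' q : T, dyadicCost s q.1 * dyadicCost (n - s) Q := by
        refine ENNReal.tsum_le_tsum fun q => ?_
        rw [hsplit]
        exact mul_le_mul_right ((hT q q.2).cost_le (by linarith)) _
    _ = (∑' q : T, dyadicCost s q.1) * dyadicCost (n - s) Q := ENNReal.tsum_mul_right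
    _ < dyadicCost s Q * dyadicCost (n - s) Q :=
        ENNReal.mul_lt_mul_left (dyadicCost_pos _ _).ne' ENNReal.ofReal_ne_top hcost
    _ = dyadicCost (n : ℝ) Q := (hsplit Q).symm

/-- If `E` satisfies a volume content bound, a dyadic family of total cost less than that of `Q`
cannot cover the part of `E` in the interior of `Q`. -/
theorem HasVolumeContentBound.not_subset {s : ℝ} {m₀ : ℕ}
    {E : Set (EuclideanSpace ℝ (Fin n))} (hE : HasVolumeContentBound s m₀ E) (hsn : s ≤ n)
    {Q : ℕ × (Fin n → ℤ)} (hQ : m₀ ≤ Q.1) {T : Set (ℕ × (Fin n → ℤ))}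
    (hT : ∀ q ∈ T, DyadicLE q Q) (hcost : ∑' q : T, dyadicCost s q.1 < dyadicCost s Q) :
    ¬ E ∩ dyadicOpenCube Q ⊆ ⋃ q ∈ T, dyadicCube q := by
  intro hcov
  obtain ⟨C, hC, hbound⟩ := hE
  have hfin : ∑' q : T, dyadicCost s q.1 ≠ ∞ := hcost.ne_top
  have hvol := tsum_dyadicCost_dim_lt hsn hT hcost
  -- The bound is applied to the interior of `Q` minus finitely many closed cubes of `T`. What is
  -- left has volume at least `θ`, whichever cubes are removed, yet it is covered by a tail of a
  -- convergent series. Hence the value of `C` is irrelevant.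
  let θ := dyadicCost (n : ℝ) Q - ∑' q : T, dyadicCost (n : ℝ) q.1
  have hθpos : 0 < θ := tsub_pos_of_lt hvol
  have hlow : ∀ A : Finset T, θ ≤ C * ∑' q : {q // q ∉ A}, dyadicCost s q.1.1 := by
    intro A
    let K : Set (EuclideanSpace ℝ (Fin n)) 
      := ⋃ q ∈ A, dyadicClosedCube q.1
    have hKclosed : IsClosed K := A.finite_toSet.isClosed_biUnion
      fun q _ => isClosed_dyadicClosedCube _
    have hKvol : volume K ≤ ∑' q : T, dyadicCost (n : ℝ) q.1 := by
      calc volume K ≤ ∑ q ∈ A, volume (dyadicClosedCube q.1) :=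
            measure_biUnion_finset_le _ _
        _ = ∑ q ∈ A, dyadicCost (n : ℝ) q.1 := by simp only [volume_closed_eq_cost]
        _ ≤ _ := ENNReal.sum_le_tsum A
    have h1 : volume (dyadicOpenCube Q \ K) ≤
        C * ∑' q : (Subtype.val '' {q : T | q ∉ A} : Set (ℕ × (Fin n → ℤ))), dyadicCost s q.1 := by
      refine hbound _ ((isOpen_dyadicOpenCube Q).sdiff hKclosed) _ ?_ ?_
      · rintro _ ⟨q, _, rfl⟩
        exact hQ.trans (hT q q.2).1
      · rintro x ⟨hxE, hxQ, hxK⟩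
        obtain ⟨q, hq, hxq⟩ := mem_iUnion₂.1 (hcov ⟨hxE, hxQ⟩)
        refine mem_iUnion₂.2 ⟨q, ⟨⟨q, hq⟩, fun hqA => hxK ?_, rfl⟩, hxq⟩
        exact mem_iUnion₂.2 ⟨⟨q, hq⟩, hqA, dyadicCube_subset_closedCube _ hxq⟩
    have h2 : ∑' q : (Subtype.val '' {q : T | q ∉ A} : Set (ℕ × (Fin n → ℤ))), dyadicCost s q.1 =
        ∑' q : {q // q ∉ A}, dyadicCost s q.1.1 :=
      tsum_image (dyadicCost s) Subtype.val_injective.injOn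
    calc θ ≤ dyadicCost (n : ℝ) Q - volume K := tsub_le_tsub_left hKvol _
      _ = volume (dyadicOpenCube Q) - volume K := by rw [volume_open_eq_cost]
      _ ≤ volume (dyadicOpenCube Q \ K) := le_measure_sdiff
      _ ≤ _ := h1.trans_eq (by rw [h2])
  have hlim : Tendsto (fun A : Finset T => C * ∑' q : {q // q ∉ A}, dyadicCost s q.1.1)
      atTop (𝓝 (C * 0)) :=
    ENNReal.Tendsto.const_mul (ENNReal.tendsto_tsum_compl_atTop_zero hfin) (Or.inr hC)
  rw [mul_zero] at hlim
  exact hθpos.not_ge (ge_of_tendsto' hlim hlow)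

/-- Pairwise disjoint descendants of `Q` have total weight at most the weight of `Q`. -/
theorem tsum_dyadicWeight_le (s : ℝ) (P : ℕ → ℕ × (Fin n → ℤ)) {Q : ℕ × (Fin n → ℤ)}
    {T : Set (ℕ × (Fin n → ℤ))} (hT : ∀ q ∈ T, DyadicLE q Q)
    (hdisj : ∀ p ∈ T, ∀ q ∈ T, ∀ x, x ∈ dyadicCube p → x ∈ dyadicCube q → p = q) :
    ∑' q : T, dyadicWeight s P q ≤ dyadicWeight s P Q := by
  unfold dyadicWeight
  rw [ENNReal.tsum_comm]
  refine ENNReal.tsum_le_tsum fun l => ?_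
  by_cases h : ∃ q : T, DyadicLE (P l) q
  · obtain ⟨q, hq⟩ := h
    rw [tsum_eq_single q]
    · rw [indicator_of_mem (show l ∈ {l | DyadicLE (P l) Q} from hq.trans (hT q q.2))]
      exact indicator_le_self _ _ _
    · intro q' hne
      refine indicator_of_notMem (fun hq' => hne ?_) _
      obtain ⟨x, hx⟩ := nonempty_dyadicCube (P l)
      exact Subtype.ext (hdisj _ q'.2 _ q.2 x (hq'.2 hx) (hq.2 hx))
  · push Not at h
    refine (ENNReal.tsum_eq_zero.2 fun q => ?_).trans_le zero_le
    exact indicator_of_notMem (show l ∉ {l | DyadicLE (P l) q.1} from h q) _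

/-- The inductive step of the nested construction: being lighter than its own cost and contained in
no `P l` is passed on to a smaller cube inside `E`. The maximal cubes violating the weight condition
are too cheap to cover `E` in `Q`, and small cubes around an uncovered point are good. -/
theorem HasVolumeContentBound.exists_descendant {s : ℝ} {m₀ : ℕ}
    {E : Set (EuclideanSpace ℝ (Fin n))} (hE : HasVolumeContentBound s m₀ E) (hEo : IsOpen E)
    (hsn : s ≤ n) (P : ℕ → ℕ × (Fin n → ℤ))
    {Q : ℕ × (Fin n → ℤ)} (hQ : m₀ ≤ Q.1) (hw : dyadicWeight s P Q < dyadicCost s Q)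
    (hP : ∀ l, ¬ DyadicLE Q (P l)) :
    ∃ q : ℕ × (Fin n → ℤ), Q.1 < q.1 ∧ dyadicClosedCube q ⊆ E ∩ dyadicOpenCube Q ∧
      dyadicWeight s P q < dyadicCost s q ∧ ∀ l, ¬ DyadicLE q (P l) := by
  let W : Set (ℕ × (Fin n → ℤ)) := {q | DyadicLE q Q ∧ dyadicCost s q ≤ dyadicWeight s P q}
  let T : Set (ℕ × (Fin n → ℤ)) := {q ∈ W | ∀ p ∈ W, DyadicLE q p → p.1 = q.1}
  -- Levels are natural numbers, so among the cubes of `W` containing `x` there is a coarsest one.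
  have hTW : ∀ x, ∀ p ∈ W, x ∈ dyadicCube p → ∃ q ∈ T, x ∈ dyadicCube q := by
    intro x p hp hxp
    have hex : ∃ m, (m, dyadicIndex m x) ∈ W := ⟨p.1, by
      rwa [mk_dyadicIndex_of_mem hxp]⟩
    classical
    refine ⟨(Nat.find hex, _), ⟨Nat.find_spec hex, fun r hr hle => ?_⟩,
      mem_dyadicCube_index _ x⟩
    refine le_antisymm hle.1 (Nat.find_min' hex ?_)
    have hxr : x ∈ dyadicCube r := hle.2 (mem_dyadicCube_index _ x)
    rwa [mk_dyadicIndex_of_mem hxr]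
  have hTdisj : ∀ p ∈ T, ∀ q ∈ T, ∀ x, x ∈ dyadicCube p → x ∈ dyadicCube q → p = q := by
    intro p hp q hq x hxp hxq
    rcases le_total q.1 p.1 with h | h
    · exact dyadic_eq_of_mem (hp.2 q hq.1 (.of_mem h hxp hxq)) hxp hxq
    · exact dyadic_eq_of_mem (hq.2 p hp.1 (.of_mem h hxq hxp)).symm hxp hxq
  have hcost : ∑' q : T, dyadicCost s q.1 < dyadicCost s Q :=
    calc ∑' q : T, dyadicCost s q.1 ≤ ∑' q : T, dyadicWeight s P q :=
          ENNReal.tsum_le_tsum fun q => q.2.1.2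
      _ ≤ dyadicWeight s P Q := tsum_dyadicWeight_le s P (fun q hq => hq.1.1) hTdisj
      _ < _ := hw
  obtain ⟨x, ⟨hxE, hxQ⟩, hx⟩ := Set.not_subset.1 (hE.not_subset hsn hQ (fun q hq => hq.1.1) hcost)
  have hxW : ∀ p ∈ W, x ∉ dyadicCube p := fun p hp hxp => by
    obtain ⟨q, hq, hxq⟩ := hTW x p hp hxp
    exact hx (mem_iUnion₂.2 ⟨q, hq, hxq⟩)
  obtain ⟨m₁, hm₁⟩ := exists_dyadicClosedCube_subset (hEo.inter (isOpen_dyadicOpenCube Q))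
    ⟨hxE, hxQ⟩
  have hxQ' := dyadicOpenCube_subset Q hxQ
  let q : ℕ × (Fin n → ℤ) := (max m₁ (Q.1 + 1), dyadicIndex (max m₁ (Q.1 + 1)) x)
  have hxq : x ∈ dyadicCube q := mem_dyadicCube_index _ x
  have hlt : Q.1 < q.1 := lt_of_lt_of_le (Nat.lt_succ_self _) (le_max_right _ _)
  refine ⟨q, hlt, hm₁ _ (le_max_left _ _), ?_, fun l hl => ?_⟩
  · by_contra! hcon
    exact hxW q ⟨.of_mem hlt.le hxq hxQ', hcon⟩ hxq
  · have hxl := hl.2 hxq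
    -- A cube `P l` finer than `Q` lies in `W`, because its own cost is a term of its weight; a
    -- coarser one would contain `Q`.
    rcases le_total Q.1 (P l).1 with h | h
    · refine hxW (P l) ⟨.of_mem h hxl hxQ', ?_⟩ hxl
      have hmem : l ∈ {l' | DyadicLE (P l') (P l)} := ⟨le_rfl, subset_rfl⟩
      calc dyadicCost s (P l) = {l' | DyadicLE (P l') (P l)}.indicator
            (fun l => dyadicCost s (P l)) l :=
          (indicator_of_mem hmem fun l => dyadicCost s (P l)).symm
        _ ≤ _ := ENNReal.le_tsum l
    · exact hP l (.of_mem h hxQ' hxl)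

/-- Dyadic cubes of total cost less than that of `Q` do not cover the part in `Q` of a countable
intersection of open sets that satisfy volume content bounds. -/
theorem exists_mem_iInter_notMem_dyadicCube {s : ℝ} {m₀ : ℕ}
    {E : ℕ → Set (EuclideanSpace ℝ (Fin n))} (hE : ∀ k, HasVolumeContentBound s m₀ (E k))
    (hEo : ∀ k, IsOpen (E k)) (hs : 0 < s) (hsn : s ≤ n) (P : ℕ → ℕ × (Fin n → ℤ))
    {Q : ℕ × (Fin n → ℤ)} (hQ : m₀ ≤ Q.1) (hcost : ∑' l, dyadicCost s (P l) < dyadicCost s Q) :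
    ∃ x ∈ (⋂ k, E k) ∩ dyadicCube Q, ∀ l, x ∉ dyadicCube (P l) := by
  let G : Set (ℕ × (Fin n → ℤ)) := {q | m₀ ≤ q.1 ∧ dyadicWeight s P q < dyadicCost s q ∧
    ∀ l, ¬ DyadicLE q (P l)}
  have hstep : ∀ k, ∀ q : G, ∃ q' : G, q.1.1 < q'.1.1 ∧
      dyadicClosedCube q'.1 ⊆ E k ∩ dyadicOpenCube q.1 := by
    rintro k ⟨q, hq1, hq2, hq3⟩
    obtain ⟨q', h1, h2, h3, h4⟩ := (hE k).exists_descendant (hEo k) hsn P hq1 hq2 hq3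
    exact ⟨⟨q', hq1.trans h1.le, h3, h4⟩, h1, h2⟩
  choose next hnext1 hnext2 using hstep
  have hQG : Q ∈ G := by
    refine ⟨hQ, lt_of_le_of_lt (ENNReal.tsum_le_tsum fun l => indicator_le_self _ _ _) hcost,
      fun l hl => ?_⟩
    exact absurd ((ENNReal.le_tsum l).trans_lt hcost) (not_lt.2 (hl.cost_le hs.le))
  let q : ℕ → G := fun k => Nat.rec ⟨Q, hQG⟩ (fun k q => next k q) k
  have hq : ∀ k, dyadicClosedCube (q (k + 1)).1 ⊆ E k ∩ dyadicOpenCube (q k).1 :=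
    fun k => hnext2 k (q k)
  have hlevel : ∀ k, k ≤ (q k).1.1 := by
    intro k
    induction k with
    | zero => exact Nat.zero_le _
    | succ k ih => exact ih.trans_lt (hnext1 k (q k))
  have hne : (⋂ k, dyadicClosedCube (q k).1).Nonempty := by
    refine IsCompact.nonempty_iInter_of_sequence_nonempty_isCompact_isClosed _ (fun k => ?_)
      (fun k => (nonempty_dyadicCube _).mono (dyadicCube_subset_closedCube _)) ?_
      (fun k => isClosed_dyadicClosedCube _)
    · exact (hq k).trans (inter_subset_right.trans
        ((dyadicOpenCube_subset _).trans (dyadicCube_subset_closedCube _)))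
    · refine Metric.isCompact_of_isClosed_isBounded (isClosed_dyadicClosedCube _)
        (Metric.isBounded_iff.2 ⟨_, fun x hx y hy => dist_le_of_mem_dyadicClosedCube hx hy⟩)
  obtain ⟨x, hx⟩ := hne
  have hx' : ∀ k, x ∈ E k ∩ dyadicOpenCube (q k).1 := fun k => hq k (mem_iInter.1 hx (k + 1))
  refine ⟨x, ⟨mem_iInter.2 fun k => (hx' k).1, dyadicOpenCube_subset _ (hx' 0).2⟩,
    fun l hl => ?_⟩
  -- At step `k = (P l).1` the cube `q k` is at least as fine as `P l`; sharing `x`, it would be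
  -- contained in `P l`.
  exact (q (P l).1).2.2.2 l (.of_mem (hlevel _) (dyadicOpenCube_subset _ (hx' _).2) hl)

end Content
-- From dyadic content to Hausdorff measure.
section HausdorffBound

open Set Filter Topology
open scoped ENNReal

variable {n : ℕ}

theorem tendsto_ofReal_half_pow_rpow {s : ℝ} (hs : 0 < s) :
    Tendsto (fun m : ℕ => ENNReal.ofReal (((1 / 2 : ℝ) ^ m) ^ s)) atTop (𝓝 0) := by
  have h : Tendsto (fun m : ℕ => ((1 / 2 : ℝ) ^ m) ^ s) atTop (𝓝 (0 ^ s)) :=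
    (tendsto_pow_atTop_nhds_zero_of_lt_one (by norm_num) (by norm_num)).rpow_const (Or.inr hs.le)
  rw [Real.zero_rpow hs.ne'] at h
  simpa using ENNReal.tendsto_ofReal h

/-- The smallest cost of a dyadic cube containing a given set. -/
noncomputable def dyadicHullCost (n : ℕ) (s : ℝ) (A : Set (EuclideanSpace ℝ (Fin n))) : ℝ≥0∞ :=
  ⨅ (q : ℕ × (Fin n → ℤ)) (_ : A ⊆ dyadicCube q), dyadicCost s q

theorem dyadicHullCost_empty {s : ℝ} (hs : 0 < s) : dyadicHullCost n s ∅ = 0 := by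
  refine le_antisymm (ge_of_tendsto' (tendsto_ofReal_half_pow_rpow hs) fun m => ?_) zero_le
  exact iInf₂_le (m, 0) (empty_subset _)

/-- The content obtained by covering with dyadic cubes of arbitrary sizes. -/
noncomputable def dyadicContent (n : ℕ) {s : ℝ} (hs : 0 < s) :
    OuterMeasure (EuclideanSpace ℝ (Fin n)) :=
  OuterMeasure.ofFunction (dyadicHullCost n s) (dyadicHullCost_empty hs)

theorem le_dyadicContent {s : ℝ} (hs : 0 < s) {S : Set (EuclideanSpace ℝ (Fin n))} {c : ℝ≥0∞}
    (h : ∀ P : ℕ → ℕ × (Fin n → ℤ), S ⊆ ⋃ l, dyadicCube (P l) → c ≤ ∑' l, dyadicCost s (P l)) :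
    c ≤ dyadicContent n hs S := by
  rw [dyadicContent, OuterMeasure.ofFunction_apply]
  refine le_iInf₂ fun t ht => ENNReal.le_of_forall_pos_le_add fun ε hε hfin => ?_
  obtain ⟨ε', hε', hsum⟩ := ENNReal.exists_pos_sum_of_countable
    (ENNReal.coe_ne_zero.2 hε.ne') ℕ
  -- A set lying in no dyadic cube has hull cost `∞`; finiteness of the sum excludes such sets.
  have hex : ∀ l, ∃ q : ℕ × (Fin n → ℤ), t l ⊆ dyadicCube q ∧
      dyadicCost s q < dyadicHullCost n s (t l) + ε' l := by
    intro l
    have hlt : dyadicHullCost n s (t l) < dyadicHullCost n s (t l) + ε' l :=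
      ENNReal.lt_add_right (ne_top_of_le_ne_top hfin.ne (ENNReal.le_tsum l))
        (ENNReal.coe_ne_zero.2 (hε' l).ne')
    conv_lhs at hlt => rw [dyadicHullCost]
    obtain ⟨q, hq⟩ := iInf_lt_iff.1 hlt
    obtain ⟨hsub, hq⟩ := iInf_lt_iff.1 hq
    exact ⟨q, hsub, hq⟩
  choose P hP1 hP2 using hex
  calc c ≤ ∑' l, dyadicCost s (P l) := h P (ht.trans (iUnion_mono hP1))
    _ ≤ ∑' l, (dyadicHullCost n s (t l) + ε' l) := ENNReal.tsum_le_tsum fun l => (hP2 l).le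
    _ = ∑' l, dyadicHullCost n s (t l) + ∑' l, (ε' l : ℝ≥0∞) := ENNReal.tsum_add
    _ ≤ _ := by gcongr

/-- In each coordinate the set meets at most three consecutive dyadic intervals of length `2⁻ᵐ`,
hence the factor `3 ^ n`. -/
theorem dyadicContent_le_of_dist_le {s : ℝ} (hs : 0 < s) {A : Set (EuclideanSpace ℝ (Fin n))}
    {m : ℕ} (hA : ∀ x ∈ A, ∀ y ∈ A, dist x y ≤ (1 / 2 : ℝ) ^ m) :
    dyadicContent n hs A ≤ 3 ^ n * ENNReal.ofReal (((1 / 2 : ℝ) ^ m) ^ s) := by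
  rcases A.eq_empty_or_nonempty with rfl | ⟨a, ha⟩
  · simp
  set c := dyadicIndex m a with hc
  let I : Finset (Fin n → ℤ) := Fintype.piFinset fun i => Finset.Icc (c i - 1) (c i + 1)
  have hcov : A ⊆ ⋃ k ∈ I, dyadicCube (m, k) := by
    intro x hx
    refine mem_iUnion₂.2 ⟨dyadicIndex m x, Fintype.mem_piFinset.2 fun i => ?_,
      mem_dyadicCube_index m x⟩
    have h1 : |x i - a i| ≤ (1 / 2 : ℝ) ^ m := by
      have := PiLp.norm_apply_le (x - a) i
      rw [← dist_eq_norm] at this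
      exact this.trans (hA x hx a ha)
    have h2 : |2 ^ m * x i - 2 ^ m * a i| ≤ (1 : ℝ) := by
      rw [← mul_sub, abs_mul, abs_of_pos (by positivity)]
      calc (2 : ℝ) ^ m * |x i - a i| ≤ 2 ^ m * (1 / 2) ^ m := by gcongr
        _ = 1 := by rw [← mul_pow]; norm_num
    rw [abs_le] at h2
    rw [Finset.mem_Icc, hc, dyadicIndex, dyadicIndex]
    constructor
    · rw [← Int.floor_sub_one]
      exact Int.floor_le_floor (by linarith)
    · rw [← Int.floor_add_one]
      exact Int.floor_le_floor (by linarith)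
  calc dyadicContent n hs A ≤ dyadicContent n hs (⋃ k ∈ I, dyadicCube (m, k)) :=
        measure_mono hcov
    _ ≤ ∑ k ∈ I, dyadicContent n hs (dyadicCube (m, k)) := measure_biUnion_finset_le _ _
    _ ≤ ∑ _k ∈ I, ENNReal.ofReal (((1 / 2 : ℝ) ^ m) ^ s) :=
        Finset.sum_le_sum fun k _ => (OuterMeasure.ofFunction_le _).trans
          (iInf₂_le (m, k) (Subset.refl _))
    _ = 3 ^ n * ENNReal.ofReal (((1 / 2 : ℝ) ^ m) ^ s) := by
        have hcard : I.card = 3 ^ n := by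
          have h3 : ∀ i, c i + 1 + 1 - (c i - 1) = 3 := fun i => by ring
          simp [I, Fintype.card_piFinset, h3]
        simp [hcard]

theorem dyadicContent_le_ediam {s : ℝ} (hs : 0 < s) {A : Set (EuclideanSpace ℝ (Fin n))}
    (hA : Metric.ediam A ≤ 1) :
    dyadicContent n hs A ≤ 3 ^ n * ENNReal.ofReal (2 ^ s) * Metric.ediam A ^ s := by
  have hfin : Metric.ediam A ≠ ∞ := ne_top_of_le_ne_top ENNReal.one_ne_top hA
  set d := (Metric.ediam A).toReal with hd
  have hdA : Metric.ediam A = ENNReal.ofReal d := (ENNReal.ofReal_toReal hfin).symm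
  have hd1 : d ≤ 1 := ENNReal.toReal_le_of_le_ofReal zero_le_one (by simpa using hA)
  have hdist : ∀ x ∈ A, ∀ y ∈ A, dist x y ≤ d := fun x hx y hy =>
    (edist_le_ofReal ENNReal.toReal_nonneg).1 ((Metric.edist_le_ediam_of_mem hx hy).trans_eq hdA)
  have hd0 : 0 ≤ d := ENNReal.toReal_nonneg
  rcases hd0.eq_or_lt with h0 | hpos
  · have hlim : Tendsto (fun m : ℕ => (3 : ℝ≥0∞) ^ n * ENNReal.ofReal (((1 / 2 : ℝ) ^ m) ^ s))
        atTop (𝓝 (3 ^ n * 0)) :=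
      ENNReal.Tendsto.const_mul (tendsto_ofReal_half_pow_rpow hs) (Or.inr (by simp))
    rw [mul_zero] at hlim
    refine (ge_of_tendsto' hlim fun m => dyadicContent_le_of_dist_le hs fun x hx y hy => ?_).trans
      zero_le
    exact (hdist x hx y hy).trans (h0 ▸ by positivity)
  -- With `2⁻⁽ᵐ⁺¹⁾ < d ≤ 2⁻ᵐ`, replacing `d` by `2⁻ᵐ` costs at most the factor `2 ^ s`.
  · obtain ⟨m, hm1, hm2⟩ := exists_nat_pow_near_of_lt_one hpos hd1
      (show (0 : ℝ) < 1 / 2 by norm_num) (by norm_num)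
    refine (dyadicContent_le_of_dist_le hs fun x hx y hy => (hdist x hx y hy).trans hm2).trans ?_
    rw [mul_assoc, hdA, ENNReal.ofReal_rpow_of_pos hpos, ← ENNReal.ofReal_mul (by positivity),
      ← Real.mul_rpow (by norm_num) hd0]
    gcongr
    rw [pow_succ] at hm1
    linarith

/-- A lower bound for dyadic coverings of `S` is, up to a constant, a lower bound for the
Hausdorff measure of `S`. -/
theorem le_mul_hausdorffMeasure {s : ℝ} (hs : 0 < s) {S : Set (EuclideanSpace ℝ (Fin n))}
    {c : ℝ≥0∞}
    (h : ∀ P : ℕ → ℕ × (Fin n → ℤ), S ⊆ ⋃ l, dyadicCube (P l) → c ≤ ∑' l, dyadicCost s (P l)) :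
    c ≤ 3 ^ n * ENNReal.ofReal (2 ^ s) * Measure.hausdorffMeasure s S := by
  set K : ℝ≥0∞ := 3 ^ n * ENNReal.ofReal (2 ^ s) with hK
  have hK0 : K ≠ 0 := mul_ne_zero (by simp) (ENNReal.ofReal_pos.2 (by positivity)).ne'
  have hKtop : K ≠ ∞ := ENNReal.mul_ne_top (by simp) ENNReal.ofReal_ne_top
  have hle : K⁻¹ • dyadicContent n hs ≤ OuterMeasure.mkMetric fun r : ℝ≥0∞ => r ^ s := by
    refine OuterMeasure.le_mkMetric _ _ 1 one_pos fun A hA => ?_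
    rw [smul_apply, smul_eq_mul, mul_comm, ← div_eq_mul_inv]
    exact ENNReal.div_le_of_le_mul' (dyadicContent_le_ediam hs hA)
  have h2 : K⁻¹ * dyadicContent n hs S ≤ Measure.hausdorffMeasure s S := by
    refine (hle S).trans_eq ?_
    rw [← Measure.coe_toOuterMeasure, Measure.hausdorffMeasure, Measure.mkMetric_toOuterMeasure]
  calc c ≤ dyadicContent n hs S := le_dyadicContent hs h
    _ = K * (K⁻¹ * dyadicContent n hs S) := by
        rw [← mul_assoc, ENNReal.mul_inv_cancel hK0 hKtop, one_mul]
    _ ≤ _ := by gcongr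

/-- The level `Q.1 + p` descendants have total volume cost equal to that of `Q`, so their total
`s`-cost grows like `2 ^ (p (n - s))`. Additivity of the measure bounds this total by `K * H`, which
is impossible for finite `H`. -/
theorem hausdorffMeasure_inter_dyadicCube_eq_top {s : ℝ} (hs : 0 < s) (hsn : s < n)
    {L : Set (EuclideanSpace ℝ (Fin n))} {Q : ℕ × (Fin n → ℤ)}
    (hL : ∀ q, DyadicLE q Q → ∀ P : ℕ → ℕ × (Fin n → ℤ),
      L ∩ dyadicCube q ⊆ ⋃ l, dyadicCube (P l) → dyadicCost s q ≤ ∑' l, dyadicCost s (P l)) :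
    Measure.hausdorffMeasure s (L ∩ dyadicCube Q) = ∞ := by
  by_contra hfin
  set K : ℝ≥0∞ := 3 ^ n * ENNReal.ofReal (2 ^ s) with hK
  have hKtop : K ≠ ∞ := ENNReal.mul_ne_top (by simp) ENNReal.ofReal_ne_top
  set H := Measure.hausdorffMeasure s (L ∩ dyadicCube Q) with hH
  have hbound : ∀ p : ℕ, dyadicCost (n : ℝ) Q ≤
      ENNReal.ofReal (((1 / 2 : ℝ) ^ (Q.1 + p)) ^ ((n : ℝ) - s)) * (K * H) := by
    intro p
    let D : Set (ℕ × (Fin n → ℤ)) := {q | q.1 = Q.1 + p ∧ DyadicLE q Q}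
    have hdisj : Pairwise (Function.onFun Disjoint fun q : D => dyadicCube q.1) := by
      intro q q' hne
      refine Set.disjoint_left.2 fun x hx hx' => hne (Subtype.ext ?_)
      exact dyadic_eq_of_mem (q'.2.1.trans q.2.1.symm) hx hx'
    have hcov : dyadicOpenCube Q ⊆ ⋃ q : D, dyadicClosedCube q.1 := by
      intro x hx
      refine mem_iUnion.2 ⟨⟨(Q.1 + p, dyadicIndex (Q.1 + p) x), rfl, ?_⟩, ?_⟩
      · exact .of_mem (Nat.le_add_right _ _) (mem_dyadicCube_index _ x)
          (dyadicOpenCube_subset _ hx)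
      · exact dyadicCube_subset_closedCube _ (mem_dyadicCube_index _ x)
    calc dyadicCost (n : ℝ) Q = volume (dyadicOpenCube Q) := (volume_open_eq_cost Q).symm
      _ ≤ ∑' q : D, volume (dyadicClosedCube q.1) :=
          (measure_mono hcov).trans (measure_iUnion_le _)
      _ = ∑' q : D, ENNReal.ofReal (((1 / 2 : ℝ) ^ (Q.1 + p)) ^ ((n : ℝ) - s)) *
            dyadicCost s q.1 := by
          refine tsum_congr fun q => ?_
          rw [volume_closed_eq_cost, ← q.2.1, ← dyadicCost, dyadicCost_mul, sub_add_cancel]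
      _ = ENNReal.ofReal (((1 / 2 : ℝ) ^ (Q.1 + p)) ^ ((n : ℝ) - s)) *
            ∑' q : D, dyadicCost s q.1 := ENNReal.tsum_mul_left
      _ ≤ _ := by
          gcongr
          calc ∑' q : D, dyadicCost s q.1
              ≤ ∑' q : D, K * (Measure.hausdorffMeasure s).restrict L (dyadicCube q.1) := by
                refine ENNReal.tsum_le_tsum fun q => ?_
                rw [Measure.restrict_apply (measurableSet_dyadicCube _), inter_comm]
                exact le_mul_hausdorffMeasure hs (hL q.1 q.2.2)
            _ = K * ∑' q : D, (Measure.hausdorffMeasure s).restrict L (dyadicCube q.1) :=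
                ENNReal.tsum_mul_left
            _ ≤ K * (Measure.hausdorffMeasure s).restrict L (dyadicCube Q) := by
                gcongr
                refine (tsum_meas_le_meas_iUnion_of_disjoint _
                  (fun q : D => measurableSet_dyadicCube q.1) hdisj).trans ?_
                exact measure_mono (iUnion_subset fun q => q.2.2.2)
            _ = K * H := by
                rw [Measure.restrict_apply (measurableSet_dyadicCube _), inter_comm]
  have hlim : Tendsto (fun p : ℕ =>
      ENNReal.ofReal (((1 / 2 : ℝ) ^ (Q.1 + p)) ^ ((n : ℝ) - s)) * (K * H)) atTop
      (𝓝 (0 * (K * H))) := by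
    refine ENNReal.Tendsto.mul_const ?_ (Or.inr (ENNReal.mul_ne_top hKtop hfin))
    have := (tendsto_add_atTop_iff_nat Q.1).2 (tendsto_ofReal_half_pow_rpow (sub_pos.2 hsn))
    simpa only [add_comm] using this
  rw [zero_mul] at hlim
  exact (dyadicCost_pos (n : ℝ) Q).not_ge (ge_of_tendsto' hlim hbound)

/-- A countable intersection of open sets that satisfy volume content bounds has infinite
`s`-dimensional Hausdorff measure in every ball. -/
theorem hausdorffMeasure_ball_inter_iInter_eq_top {s : ℝ} {m₀ : ℕ}
    {E : ℕ → Set (EuclideanSpace ℝ (Fin n))} (hE : ∀ k, HasVolumeContentBound s m₀ (E k))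
    (hEo : ∀ k, IsOpen (E k)) (hs : 0 < s) (hsn : s < n) (x : EuclideanSpace ℝ (Fin n))
    {r : ℝ} (hr : 0 < r) :
    Measure.hausdorffMeasure s (Metric.ball x r ∩ ⋂ k, E k) = ∞ := by
  obtain ⟨m₁, hm₁⟩ := exists_dyadicClosedCube_subset Metric.isOpen_ball (Metric.mem_ball_self hr)
  set Q : ℕ × (Fin n → ℤ) := (max m₀ m₁, dyadicIndex (max m₀ m₁) x)
  have hQ : dyadicCube Q ⊆ Metric.ball x r :=
    (dyadicCube_subset_closedCube Q).trans (hm₁ _ (le_max_right _ _))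
  refine measure_mono_top (s₁ := (⋂ k, E k) ∩ dyadicCube Q)
    (fun y hy => ⟨hQ hy.2, hy.1⟩) (hausdorffMeasure_inter_dyadicCube_eq_top hs hsn ?_)
  intro q hq P hP
  by_contra! hlt
  obtain ⟨y, hy, hyP⟩ := exists_mem_iInter_notMem_dyadicCube hE hEo hs hsn.le P
    ((le_max_left _ _).trans hq.1) hlt
  obtain ⟨l, hl⟩ := mem_iUnion.1 (hP hy)
  exact hyP l hl

end HausdorffBound
-- Mass estimates from local scaling.
section LocalMass

open Set Filter Topology Metric
open scoped ENNReal

/-- The local scaling inequalities for one set and one measure, with given constants. -/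
def HasLocalScaling {n : ℕ} (μ : Measure (EuclideanSpace ℝ (Fin n)))
    (F : Set (EuclideanSpace ℝ (Fin n))) (κ c₃ c₄ r₁ : ℝ) : Prop :=
  ∀ r δ : ℝ, 0 < r → r < r₁ → 0 ≤ δ → δ < r → ∀ x ∈ F,
    ENNReal.ofReal (c₃ * δ ^ ((n : ℝ) - κ * n) * r ^ (κ * n)) ≤ μ (ball x r ∩ nbhd F δ) ∧
    μ (ball x r ∩ nbhd F δ) ≤ ENNReal.ofReal (c₄ * δ ^ ((n : ℝ) - κ * n) * r ^ (κ * n))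

variable {n : ℕ} {μ : Measure (EuclideanSpace ℝ (Fin n))}
  {F : Set (EuclideanSpace ℝ (Fin n))} {κ c₃ c₄ r₁ s υ ρ : ℝ}

theorem isOpen_nbhd {X : Type*} [MetricSpace X] (F : Set X) (δ : ℝ) : IsOpen (nbhd F δ) :=
  isOpen_lt Metric.continuous_infEDist continuous_const

/-- The balance behind the exponent `a`: local scaling at thickness `υ` and radius `ρ`, weighted by
`υ ^ (s - n)`, gives exactly `ρ ^ n`. -/
theorem rpow_mul_rpow_of_rpow_eq (hυ : 0 < υ) (hρ : 0 < ρ)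
    (hυρ : υ ^ (s - κ * n) = ρ ^ ((n : ℝ) - κ * n)) :
    υ ^ (s - n) * υ ^ ((n : ℝ) - κ * n) * ρ ^ (κ * n) = ρ ^ n := by
  rw [← Real.rpow_add hυ, show s - n + (n - κ * n) = s - κ * n by ring, hυρ, ← Real.rpow_add hρ,
    sub_add_cancel, Real.rpow_natCast]

theorem HasLocalScaling.le_mass (hF : HasLocalScaling μ F κ c₃ c₄ r₁) (hκ1 : κ < 1)
    (hc₃ : 0 < c₃) (hυ : 0 < υ) (hρ : ρ < r₁) (h2 : 2 * υ < ρ)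
    (hυρ : υ ^ (s - κ * n) = ρ ^ ((n : ℝ) - κ * n))
    {z : EuclideanSpace ℝ (Fin n)} (hz : z ∈ F) :
    ENNReal.ofReal (ρ ^ n) ≤
      ENNReal.ofReal (2 ^ n / c₃) *
        (ENNReal.ofReal (υ ^ (s - n)) * μ (ball z (ρ / 2) ∩ nbhd F υ)) := by
  have hρ0 : 0 < ρ := by linarith
  have h := (hF (ρ / 2) υ (by linarith) (by linarith) hυ.le (by linarith) z hz).1
  refine le_trans ?_ (mul_le_mul_right (mul_le_mul_right h _) _)
  rw [← ENNReal.ofReal_mul (by positivity), ← ENNReal.ofReal_mul (by positivity)]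
  refine ENNReal.ofReal_le_ofReal ?_
  have hpow : (2 : ℝ) ^ (κ * n) ≤ 2 ^ n := by
    rw [← Real.rpow_natCast]
    refine Real.rpow_le_rpow_of_exponent_le (by norm_num) ?_
    nlinarith [hκ1, (Nat.cast_nonneg n : (0 : ℝ) ≤ n)]
  have h2pos : (0 : ℝ) < 2 ^ (κ * n) := by positivity
  have hid := rpow_mul_rpow_of_rpow_eq hυ hρ0 hυρ
  calc ρ ^ n = 1 * ρ ^ n := (one_mul _).symm
    _ ≤ (2 ^ n / 2 ^ (κ * n)) * ρ ^ n := by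
        gcongr
        rwa [one_le_div h2pos]
    _ = _ := by
        rw [← hid, Real.div_rpow hρ0.le (by norm_num)]
        field_simp

theorem HasLocalScaling.mass_le (hF : HasLocalScaling μ F κ c₃ c₄ r₁)
    (hυ : 0 < υ) (hρ : ρ < r₁) (h2 : 2 * υ < ρ)
    (hυρ : υ ^ (s - κ * n) = ρ ^ ((n : ℝ) - κ * n))
    {z : EuclideanSpace ℝ (Fin n)} (hz : z ∈ F) :
    ENNReal.ofReal (υ ^ (s - n)) * μ (ball z (ρ / 2) ∩ nbhd F υ) ≤ ENNReal.ofReal (c₄ * ρ ^ n) := by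
  have hρ0 : 0 < ρ := by linarith
  have h := (hF ρ υ hρ0 hρ hυ.le (by linarith) z hz).2
  calc ENNReal.ofReal (υ ^ (s - n)) * μ (ball z (ρ / 2) ∩ nbhd F υ)
      ≤ ENNReal.ofReal (υ ^ (s - n)) * μ (ball z ρ ∩ nbhd F υ) := by gcongr; linarith
    _ ≤ ENNReal.ofReal (υ ^ (s - n)) *
          ENNReal.ofReal (c₄ * υ ^ ((n : ℝ) - κ * n) * ρ ^ (κ * n)) := by gcongr
    _ = _ := by
        rw [← ENNReal.ofReal_mul (by positivity), ← rpow_mul_rpow_of_rpow_eq hυ hρ0 hυρ]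
        congr 1; ring

theorem measure_ball_eq [μ.IsAddHaarMeasure] (x : EuclideanSpace ℝ (Fin n)) {r : ℝ}
    (hr : 0 < r) : μ (ball x r) = ENNReal.ofReal (r ^ n) * μ (ball 0 1) := by
  rw [Measure.addHaar_ball_of_pos μ x hr, finrank_euclideanSpace_fin]

/-- Below the thickness `υ` the volume of the ball is enough, since `υ ^ (s - n) ≤ r ^ (s - n)`.
Above it the ball lies in `ball z (4 * r)` with `z ∈ F`, and local scaling applies with `υ ^ (s -
κn) ≤ r ^ (s - κn)`; this is where `κn < s` enters. -/
theorem HasLocalScaling.mass_inter_ball_le [μ.IsAddHaarMeasure]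
    (hF : HasLocalScaling μ F κ c₃ c₄ r₁) (hc₄ : 0 < c₄)
    (hs : κ * n < s) (hsn : s ≤ n) (hυ : 0 < υ) (y : EuclideanSpace ℝ (Fin n)) {r : ℝ}
    (hr : 0 < r) (hr₁ : 4 * r < r₁) :
    ENNReal.ofReal (υ ^ (s - n)) * μ (nbhd F υ ∩ ball y r) ≤
      (μ (ball 0 1) + ENNReal.ofReal (c₄ * 4 ^ n)) * ENNReal.ofReal (r ^ s) := by
  rcases lt_or_ge r υ with hlt | hge
  · calc ENNReal.ofReal (υ ^ (s - n)) * μ (nbhd F υ ∩ ball y r)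
        ≤ ENNReal.ofReal (r ^ (s - n)) * μ (ball y r) := by
          gcongr ENNReal.ofReal ?_ * μ ?_
          · exact Real.rpow_le_rpow_of_nonpos hr hlt.le (by linarith)
          · exact inter_subset_right
      _ = μ (ball 0 1) * ENNReal.ofReal (r ^ s) := by
          rw [measure_ball_eq y hr, ← mul_assoc, ← ENNReal.ofReal_mul (by positivity),
            ← Real.rpow_natCast, ← Real.rpow_add hr, sub_add_cancel, mul_comm]
      _ ≤ _ := by gcongr; exact le_self_add
  · rcases (nbhd F υ ∩ ball y r).eq_empty_or_nonempty with hemp | ⟨x, hxF, hxy⟩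
    · simp [hemp]
    obtain ⟨z, hz, hxz⟩ := Metric.infEDist_lt_iff.1 hxF
    rw [edist_lt_ofReal] at hxz
    rw [mem_ball] at hxy
    have hsub : nbhd F υ ∩ ball y r ⊆ ball z (4 * r) ∩ nbhd F υ := fun w hw => ⟨by
      have h1 := mem_ball.1 hw.2
      have h2 := dist_triangle4 w y x z
      rw [dist_comm y x] at h2
      rw [mem_ball]
      linarith, hw.1⟩
    have h4 : (4 : ℝ) ^ (κ * n) ≤ 4 ^ n := by
      rw [← Real.rpow_natCast]
      refine Real.rpow_le_rpow_of_exponent_le (by norm_num) ?_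
      linarith
    calc ENNReal.ofReal (υ ^ (s - n)) * μ (nbhd F υ ∩ ball y r)
        ≤ ENNReal.ofReal (υ ^ (s - n)) *
          ENNReal.ofReal (c₄ * υ ^ ((n : ℝ) - κ * n) * (4 * r) ^ (κ * n)) := by
          gcongr
          exact (measure_mono hsub).trans
            (hF (4 * r) υ (by linarith) hr₁ hυ.le (by linarith) z hz).2
      _ ≤ ENNReal.ofReal (c₄ * 4 ^ n) * ENNReal.ofReal (r ^ s) := by
          rw [← ENNReal.ofReal_mul (by positivity), ← ENNReal.ofReal_mul (by positivity)]
          refine ENNReal.ofReal_le_ofReal ?_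
          calc υ ^ (s - n) * (c₄ * υ ^ ((n : ℝ) - κ * n) * (4 * r) ^ (κ * n))
              = c₄ * 4 ^ (κ * n) * (υ ^ (s - κ * n) * r ^ (κ * n)) := by
                rw [show s - κ * n = (s - n) + (n - κ * n) by ring, Real.rpow_add hυ,
                  Real.mul_rpow (by norm_num) hr.le]
                ring
            _ ≤ c₄ * 4 ^ n * (r ^ (s - κ * n) * r ^ (κ * n)) := by
                gcongr
            _ = c₄ * 4 ^ n * r ^ s := by rw [← Real.rpow_add hr, sub_add_cancel]
      _ ≤ _ := by gcongr; exact le_add_self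

/-- The mass that a ball receives from pieces `S b` sitting well inside disjoint balls: a small
ball meets only one piece, and a large one is controlled by volume. -/
theorem tsum_mass_inter_ball_le [μ.IsAddHaarMeasure] {β : Type*} [Countable β]
    {z : β → EuclideanSpace ℝ (Fin n)} {ρ : β → ℝ} {S : β → Set (EuclideanSpace ℝ (Fin n))}
    {q : β → ℝ≥0∞} {K₁ K₂ : ℝ≥0∞} (hsn : s ≤ n)
    (hS : ∀ b, S b ⊆ ball (z b) (ρ b / 2))
    (hdisj : Pairwise (Function.onFun Disjoint fun b => closedBall (z b) (ρ b)))
    (hmass : ∀ b, q b * μ (S b) ≤ K₂ * μ (closedBall (z b) (ρ b)))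
    (y : EuclideanSpace ℝ (Fin n)) {r : ℝ} (hr : 0 < r) (hr1 : r ≤ 1)
    (hsmall : ∀ b, q b * μ (S b ∩ ball y r) ≤ K₁ * ENNReal.ofReal (r ^ s)) :
    ∑' b, q b * μ (S b ∩ ball y r) ≤
      (K₁ + K₂ * (ENNReal.ofReal (7 ^ n) * μ (ball 0 1))) * ENNReal.ofReal (r ^ s) := by
  -- If `4 * r ≤ ρ b`, every point of `ball y r` is within `2r + ρ b / 2 ≤ ρ b` of `z b`, hence
  -- outside the other balls. Otherwise every ball concerned has `ρ b < 4 * r` and lies within `4r +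
  -- 2r + r = 7r` of `y`.
  by_cases h : ∃ b, (S b ∩ ball y r).Nonempty ∧ 4 * r ≤ ρ b
  · obtain ⟨b, ⟨x, hxS, hxy⟩, hrb⟩ := h
    have hx1 := mem_ball.1 (hS b hxS)
    have hx2 := mem_ball.1 hxy
    rw [tsum_eq_single b]
    · exact (hsmall b).trans (by gcongr; exact le_self_add)
    · intro b' hne
      have hemp : S b' ∩ ball y r = ∅ := by
        refine eq_empty_of_forall_notMem fun w hw => ?_
        have hw1 := mem_ball.1 (hS b' hw.1)
        have hw2 := mem_ball.1 hw.2
        refine Set.disjoint_left.1 (hdisj hne) (?_ : w ∈ closedBall _ _) ?_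
        · rw [mem_closedBall]
          linarith [dist_nonneg (x := w) (y := z b')]
        · rw [mem_closedBall]
          have := dist_triangle4 w y x (z b)
          rw [dist_comm y x] at this
          linarith
      rw [hemp, measure_empty, mul_zero]
  · push Not at h
    calc ∑' b, q b * μ (S b ∩ ball y r)
        ≤ ∑' b, K₂ * μ (closedBall (z b) (ρ b) ∩ ball y (7 * r)) := by
          refine ENNReal.tsum_le_tsum fun b => ?_
          rcases (S b ∩ ball y r).eq_empty_or_nonempty with hemp | hne
          · simp [hemp]
          have hρ := h b hne
          obtain ⟨x, hxS, hxy⟩ := hne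
          have hsub : closedBall (z b) (ρ b) ⊆ ball y (7 * r) := fun w hw => by
            have h1 := mem_ball.1 (hS b hxS)
            have h2 := mem_ball.1 hxy
            have h3 := mem_closedBall.1 hw
            have h4 := dist_triangle4 w (z b) x y
            rw [dist_comm (z b) x] at h4
            rw [mem_ball]
            linarith
          rw [inter_eq_left.2 hsub]
          refine le_trans ?_ (hmass b)
          gcongr
          exact inter_subset_left
      _ = K₂ * ∑' b, μ (closedBall (z b) (ρ b) ∩ ball y (7 * r)) := ENNReal.tsum_mul_left
      _ ≤ K₂ * μ (ball y (7 * r)) := by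
          gcongr
          refine (tsum_meas_le_meas_iUnion_of_disjoint μ
            (fun b => measurableSet_closedBall.inter measurableSet_ball)
            (fun b b' hne => (hdisj hne).mono inter_subset_left inter_subset_left)).trans ?_
          exact measure_mono (iUnion_subset fun b => inter_subset_right)
      _ ≤ K₂ * (ENNReal.ofReal (7 ^ n) * μ (ball 0 1)) * ENNReal.ofReal (r ^ s) := by
          rw [measure_ball_eq y (by linarith), mul_pow, ENNReal.ofReal_mul (by positivity)]
          have hrs : ENNReal.ofReal (r ^ n) ≤ ENNReal.ofReal (r ^ s) := by
            refine ENNReal.ofReal_le_ofReal ?_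
            rw [← Real.rpow_natCast]
            exact Real.rpow_le_rpow_of_exponent_ge hr hr1 hsn
          calc K₂ * (ENNReal.ofReal (7 ^ n) * ENNReal.ofReal (r ^ n) * μ (ball 0 1))
              = K₂ * (ENNReal.ofReal (7 ^ n) * μ (ball 0 1)) * ENNReal.ofReal (r ^ n) := by ring
            _ ≤ _ := by gcongr
      _ ≤ _ := by gcongr; exact le_add_self

end LocalMass
-- Vitali selection and the mass distribution principle.
section Transference

open Set Filter Topology Metric
open scoped ENNReal

theorem mem_limsupNbhd_iff {X : Type*} [MetricSpace X] {F : ℕ → Set X} {Υ : ℕ → ℝ} {x : X} :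
    x ∈ limsupNbhd F Υ ↔ ∃ᶠ j in atTop, x ∈ nbhd (F j) (Υ j) :=
  Nat.frequently_atTop_iff_infinite.symm

theorem limsupNbhd_eq_iInter {X : Type*} [MetricSpace X] (F : ℕ → Set X) (Υ : ℕ → ℝ) :
    limsupNbhd F Υ = ⋂ k, ⋃ j ≥ k, nbhd (F j) (Υ j) := by
  ext x
  simp [mem_limsupNbhd_iff, frequently_atTop]

theorem isOpen_tailUnion {X : Type*} [MetricSpace X] (F : ℕ → Set X) (Υ : ℕ → ℝ) (k : ℕ) :
    IsOpen (⋃ j ≥ k, nbhd (F j) (Υ j)) :=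
  isOpen_biUnion fun _ _ => isOpen_nbhd _ _

theorem measurableSet_limsupNbhd {X : Type*} [MetricSpace X] [MeasurableSpace X] [BorelSpace X]
    (F : ℕ → Set X) (Υ : ℕ → ℝ) : MeasurableSet (limsupNbhd F Υ) := by
  rw [limsupNbhd_eq_iInter]
  exact MeasurableSet.iInter fun k => (isOpen_tailUnion F Υ k).measurableSet

variable {n : ℕ} {μ : Measure (EuclideanSpace ℝ (Fin n))}
  {F : ℕ → Set (EuclideanSpace ℝ (Fin n))} {κ c₃ c₄ r₁ s a : ℝ} {Υ : ℕ → ℝ}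

/-- A sequence `Υ ^ a` with `0 < a < 1` is eventually small and dominates `2 Υ`. -/
theorem eventually_rpow_scale (hΥ : Tendsto Υ atTop (𝓝 0)) (ha0 : 0 < a)
    (ha1 : a < 1) {ε : ℝ} (hε : 0 < ε) :
    ∀ᶠ j in atTop, Υ j ^ a < ε ∧ (0 < Υ j → 2 * Υ j < Υ j ^ a) := by
  have hlim : ∀ b : ℝ, 0 < b → Tendsto (fun j => Υ j ^ b) atTop (𝓝 0) := fun b hb => by
    simpa [Real.zero_rpow hb.ne'] using hΥ.rpow_const (p := b) (Or.inr hb.le)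
  filter_upwards [(hlim a ha0).eventually (gt_mem_nhds hε),
    (hlim (1 - a) (by linarith)).eventually (gt_mem_nhds (show (0 : ℝ) < 1 / 2 by norm_num))]
    with j h1 h2
  refine ⟨h1, fun hpos => ?_⟩
  have hsplit : Υ j = Υ j ^ (1 - a) * Υ j ^ a := by
    rw [← Real.rpow_add hpos, sub_add_cancel, Real.rpow_one]
  have hpos' : 0 < Υ j ^ a := by positivity
  nlinarith

/-- The Vitali selection: disjoint balls of radii `Υ j ^ a`, centred on the sets `F j` and contained
in the open set `V`, that carry a fixed proportion of the measure of `V`. -/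
theorem exists_disjoint_balls [μ.IsAddHaarMeasure] (hΥ0 : ∀ j, 0 ≤ Υ j)
    (hΥ : Tendsto Υ atTop (𝓝 0)) (ha0 : 0 < a) (ha1 : a < 1) (hr₁ : 0 < r₁)
    (hfull : μ (limsupNbhd F fun j => Υ j ^ a)ᶜ = 0) (k : ℕ)
    {V : Set (EuclideanSpace ℝ (Fin n))} (hV : IsOpen V) :
    ∃ u : Set (ℕ × EuclideanSpace ℝ (Fin n)), u.Countable ∧
      (∀ b ∈ u, k ≤ b.1 ∧ b.2 ∈ F b.1 ∧ 0 < Υ b.1 ∧ 2 * Υ b.1 < Υ b.1 ^ a ∧ Υ b.1 ^ a < r₁ ∧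
        closedBall b.2 (Υ b.1 ^ a) ⊆ V) ∧
      (u.PairwiseDisjoint fun b => closedBall b.2 (Υ b.1 ^ a)) ∧
      μ V ≤ ∑' b : u, μ (closedBall b.1.2 (5 * Υ b.1.1 ^ a)) := by
  let t : Set (ℕ × EuclideanSpace ℝ (Fin n)) := {b | k ≤ b.1 ∧ b.2 ∈ F b.1 ∧ 0 < Υ b.1 ∧
    2 * Υ b.1 < Υ b.1 ^ a ∧ Υ b.1 ^ a < r₁ ∧ closedBall b.2 (Υ b.1 ^ a) ⊆ V}
  obtain ⟨u, hut, hdisj, hcov⟩ := Vitali.exists_disjoint_subfamily_covering_enlargement_closedBall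
    t (fun b => b.2) (fun b => Υ b.1 ^ a) r₁ (fun b hb => hb.2.2.2.2.1.le) 5 (by norm_num)
  have hu : u.Countable := by
    refine hdisj.countable_of_nonempty_interior fun b hb => ?_
    have hpos : 0 < Υ b.1 ^ a := Real.rpow_pos_of_pos (hut hb).2.2.1 a
    exact ⟨b.2, ball_subset_interior_closedBall (mem_ball_self hpos)⟩
  refine ⟨u, hu, fun b hb => hut hb, hdisj, ?_⟩
  have hsub : V ∩ limsupNbhd F (fun j => Υ j ^ a) ⊆
      ⋃ b : u, closedBall b.1.2 (5 * Υ b.1.1 ^ a) := by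
    rintro x ⟨hxV, hx⟩
    obtain ⟨ε, hε, hball⟩ := Metric.isOpen_iff.1 hV x hxV
    -- Radius below `ε / 2` keeps the ball around a nearby centre `z` inside `ball x ε ⊆ V`.
    obtain ⟨j, hxj, ⟨hj1, hj2⟩, hjk⟩ := ((mem_limsupNbhd_iff.1 hx).and_eventually
      ((eventually_rpow_scale hΥ ha0 ha1 (lt_min (half_pos hε) hr₁)).and
        (eventually_ge_atTop k))).exists
    obtain ⟨z, hz, hxz⟩ := Metric.infEDist_lt_iff.1 hxj
    rw [edist_lt_ofReal] at hxz
    have hj0 : 0 < Υ j := by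
      refine (hΥ0 j).lt_of_ne fun h0 => ?_
      rw [← h0, Real.zero_rpow ha0.ne'] at hxz
      exact hxz.not_ge dist_nonneg
    have hzt : (j, z) ∈ t := by
      refine ⟨hjk, hz, hj0, hj2 hj0, hj1.trans_le (min_le_right _ _), fun w hw => hball ?_⟩
      have h1 := mem_closedBall.1 hw
      have h2 := dist_triangle w z x
      have h3 := hj1.trans_le (min_le_left _ _)
      rw [dist_comm z x] at h2
      rw [mem_ball]
      dsimp only at h1
      linarith
    obtain ⟨b, hb, hsub⟩ := hcov (j, z) hzt
    exact mem_iUnion.2 ⟨⟨b, hb⟩, hsub (mem_closedBall.2 hxz.le)⟩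
  have := hu.to_subtype
  calc μ V = μ (V ∩ limsupNbhd F fun j => Υ j ^ a) := by
        rw [measure_inter_conull hfull]
    _ ≤ _ := (measure_mono hsub).trans (measure_iUnion_le _)

/-- If `Λ(Υ ^ a)` has full measure, the open sets `⋃ j ≥ k, Δ(F j, Υ j)` have large
`s`-dimensional content in every open set `V`. -/
theorem measure_le_tsum_of_cover [μ.IsAddHaarMeasure]
    (hF : ∀ j, HasLocalScaling μ (F j) κ c₃ c₄ r₁) (hκ1 : κ < 1) (hc₃ : 0 < c₃)
    (hc₄ : 0 < c₄) (hr₁ : 0 < r₁) (hs : κ * n < s) (hsn : s < n)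
    (hΥ0 : ∀ j, 0 ≤ Υ j) (hΥ : Tendsto Υ atTop (𝓝 0)) (ha : a * ((1 - κ) * n) = s - κ * n)
    (hfull : μ (limsupNbhd F fun j => Υ j ^ a)ᶜ = 0) :
    ∃ C : ℝ≥0∞, C ≠ ∞ ∧ ∀ (k : ℕ) (V : Set (EuclideanSpace ℝ (Fin n))), IsOpen V →
      ∀ (ι : Type) [Countable ι] (y : ι → EuclideanSpace ℝ (Fin n)) (r : ι → ℝ),
        (∀ i, 0 < r i ∧ r i ≤ 1 ∧ 4 * r i < r₁) →
        (⋃ j ≥ k, nbhd (F j) (Υ j)) ∩ V ⊆ ⋃ i, ball (y i) (r i) →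
        μ V ≤ C * ∑' i, ENNReal.ofReal (r i ^ s) := by
  have hden : 0 < (1 - κ) * n := by linarith
  have ha0 : 0 < a := by
    by_contra! h
    nlinarith
  have ha1 : a < 1 := by
    by_contra! h
    nlinarith
  have hω0 : μ (ball (0 : EuclideanSpace ℝ (Fin n)) 1) ≠ 0 :=
    (measure_ball_pos μ _ one_pos).ne'
  have hω : μ (ball (0 : EuclideanSpace ℝ (Fin n)) 1) ≠ ∞ := measure_ball_lt_top.ne
  set ω := μ (ball (0 : EuclideanSpace ℝ (Fin n)) 1) with hωdef
  set K₁ := ω + ENNReal.ofReal (c₄ * 4 ^ n) with hK₁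
  -- Dividing by `ω`, the measure of the unit ball, turns the bound `c₄ * ρ ^ n` into a multiple of
  -- the measure of the ball of radius `ρ`.
  set K₂ := ENNReal.ofReal c₄ * ω⁻¹ with hK₂
  set K₃ := K₁ + K₂ * (ENNReal.ofReal (7 ^ n) * ω) with hK₃
  have hK₃top : K₃ ≠ ∞ := by
    refine ENNReal.add_ne_top.2 ⟨ENNReal.add_ne_top.2 ⟨hω, ENNReal.ofReal_ne_top⟩, ?_⟩
    exact ENNReal.mul_ne_top (ENNReal.mul_ne_top ENNReal.ofReal_ne_top
      (ENNReal.inv_ne_top.2 hω0)) (ENNReal.mul_ne_top ENNReal.ofReal_ne_top hω)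
  refine ⟨ENNReal.ofReal (5 ^ n) * ω * ENNReal.ofReal (2 ^ n / c₃) * K₃,
    ENNReal.mul_ne_top (ENNReal.mul_ne_top (ENNReal.mul_ne_top ENNReal.ofReal_ne_top hω)
      ENNReal.ofReal_ne_top) hK₃top, ?_⟩
  intro k V hV ι _ y r hr hcov
  obtain ⟨u, hu, hprop, hdisj, hμV⟩ := exists_disjoint_balls hΥ0 hΥ ha0 ha1 hr₁ hfull k hV
  have := hu.to_subtype
  let ρ : u → ℝ := fun b => Υ b.1.1 ^ a
  let S : u → Set (EuclideanSpace ℝ (Fin n)) :=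
    fun b => ball b.1.2 (ρ b / 2) ∩ nbhd (F b.1.1) (Υ b.1.1)
  let q : u → ℝ≥0∞ := fun b => ENNReal.ofReal (Υ b.1.1 ^ (s - n))
  let z : u → EuclideanSpace ℝ (Fin n) := fun b => b.1.2
  have hSball : ∀ b, S b ⊆ ball (z b) (ρ b / 2) := fun b => inter_subset_left
  have hdisj' : Pairwise (Function.onFun Disjoint fun b => closedBall (z b) (ρ b)) :=
    fun b b' hne => hdisj b.2 b'.2 (Subtype.coe_ne_coe.2 hne)
  have hρ0 : ∀ b, 0 < ρ b := fun b => Real.rpow_pos_of_pos (hprop b.1 b.2).2.2.1 a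
  have hscale : ∀ b : u, Υ b.1.1 ^ (s - κ * n) = ρ b ^ ((n : ℝ) - κ * n) := fun b => by
    rw [← Real.rpow_mul (hΥ0 _), ← ha]
    congr 1; ring
  have hclosed : ∀ b : u, ∀ t : ℝ, 0 < t → μ (closedBall b.1.2 t) = ENNReal.ofReal (t ^ n) * ω :=
    fun b t ht => by
      rw [Measure.addHaar_closedBall μ _ ht.le, finrank_euclideanSpace_fin]
  have hSsub : ∀ b, S b ⊆ ⋃ i, S b ∩ ball (y i) (r i) := by
    intro b x hx
    have hb := hprop b.1 b.2
    have hxV : x ∈ V := hb.2.2.2.2.2 (mem_closedBall.2 (by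
      have := mem_ball.1 hx.1
      have := hρ0 b
      change dist x b.1.2 ≤ ρ b
      linarith))
    obtain ⟨i, hi⟩ := mem_iUnion.1 (hcov ⟨mem_iUnion₂.2 ⟨b.1.1, hb.1, hx.2⟩, hxV⟩)
    exact mem_iUnion.2 ⟨i, hx, hi⟩
  have hlow : ∀ b, ENNReal.ofReal (ρ b ^ n) ≤
      ENNReal.ofReal (2 ^ n / c₃) * (q b * μ (S b)) := fun b => by
    obtain ⟨-, hz, hυ, h2, hρr, -⟩ := hprop b.1 b.2
    exact (hF b.1.1).le_mass hκ1 hc₃ hυ hρr h2 (hscale b) hz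
  have hup : ∀ b, q b * μ (S b) ≤ K₂ * μ (closedBall b.1.2 (ρ b)) := fun b => by
    obtain ⟨-, hz, hυ, h2, hρr, -⟩ := hprop b.1 b.2
    refine ((hF b.1.1).mass_le hυ hρr h2 (hscale b) hz).trans_eq ?_
    rw [hclosed b _ (hρ0 b), hK₂, ENNReal.ofReal_mul hc₄.le]
    calc _ = ENNReal.ofReal c₄ * ENNReal.ofReal (ρ b ^ n) * (ω⁻¹ * ω) := by
          rw [ENNReal.inv_mul_cancel hω0 hω, mul_one]
      _ = _ := by ring
  have hsum : ∀ i, ∑' b, q b * μ (S b ∩ ball (y i) (r i)) ≤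
      K₃ * ENNReal.ofReal (r i ^ s) := fun i => by
    refine tsum_mass_inter_ball_le (ρ := ρ) (z := z) (S := S) (q := q) (K₁ := K₁) (K₂ := K₂)
      hsn.le hSball hdisj' hup (y i) (hr i).1 (hr i).2.1 fun b => ?_
    have h := (hF b.1.1).mass_inter_ball_le hc₄ hs hsn.le
        (hprop b.1 b.2).2.2.1 (y i) (hr i).1 (hr i).2.2
    refine le_trans ?_ h
    exact mul_le_mul_right (measure_mono (inter_subset_inter_left _ inter_subset_right)) _
  -- Mass distribution: the total mass dominates `μ V`, and exchanging the two sums charges it to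
  -- the covering balls, at most `K₃ * r i ^ s` each.
  calc μ V ≤ ∑' b : u, μ (closedBall b.1.2 (5 * ρ b)) := hμV
    _ = ∑' b : u, ENNReal.ofReal (5 ^ n) * ω * ENNReal.ofReal (ρ b ^ n) := by
        refine tsum_congr fun b => ?_
        rw [hclosed b _ (by linarith [hρ0 b]), mul_pow, ENNReal.ofReal_mul (by positivity)]
        ring
    _ ≤ ∑' b : u, ENNReal.ofReal (5 ^ n) * ω * (ENNReal.ofReal (2 ^ n / c₃) *
          ∑' i, q b * μ (S b ∩ ball (y i) (r i))) := by
        refine ENNReal.tsum_le_tsum fun b => ?_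
        gcongr
        refine (hlow b).trans ?_
        rw [ENNReal.tsum_mul_left]
        gcongr
        exact (measure_mono (hSsub b)).trans (measure_iUnion_le _)
    _ = ENNReal.ofReal (5 ^ n) * ω * ENNReal.ofReal (2 ^ n / c₃) *
          ∑' i, ∑' b : u, q b * μ (S b ∩ ball (y i) (r i)) := by
        rw [ENNReal.tsum_mul_left, ENNReal.tsum_mul_left, ENNReal.tsum_comm, mul_assoc _ _ (tsum _)]
    _ ≤ ENNReal.ofReal (5 ^ n) * ω * ENNReal.ofReal (2 ^ n / c₃) *
          ∑' i, K₃ * ENNReal.ofReal (r i ^ s) := by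
        gcongr with i
        exact hsum i
    _ = _ := by rw [ENNReal.tsum_mul_left, ← mul_assoc]

end Transference
-- Assembly of the two parts.
section Assembly

open Set Filter Topology Metric
open scoped ENNReal

variable {n : ℕ}

theorem isAddHaarMeasure_hausdorffMeasure_euclideanSpace (n : ℕ) :
    (Measure.hausdorffMeasure (n : ℝ) : Measure (EuclideanSpace ℝ (Fin n))).IsAddHaarMeasure := by
  have h := isAddHaarMeasure_hausdorffMeasure (E := EuclideanSpace ℝ (Fin n))
  rwa [finrank_euclideanSpace_fin] at h

theorem dyadicCube_subset_ball (q : ℕ × (Fin n → ℤ)) {x : EuclideanSpace ℝ (Fin n)}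
    (hx : x ∈ dyadicCube q) : dyadicCube q ⊆ ball x ((√n + 1) * (1 / 2) ^ q.1) := by
  intro y hy
  refine (dist_le_of_mem_dyadicClosedCube (dyadicCube_subset_closedCube q hy)
    (dyadicCube_subset_closedCube q hx)).trans_lt ?_
  gcongr
  linarith

/-- The tails of the limsup set satisfy the volume content bounds. -/
theorem exists_hasVolumeContentBound {μ : Measure (EuclideanSpace ℝ (Fin n))} [μ.IsAddHaarMeasure]
    {F : ℕ → Set (EuclideanSpace ℝ (Fin n))} {κ c₃ c₄ r₁ s a : ℝ} {Υ : ℕ → ℝ}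
    (hF : ∀ j, HasLocalScaling μ (F j) κ c₃ c₄ r₁) (hκ1 : κ < 1) (hc₃ : 0 < c₃)
    (hc₄ : 0 < c₄) (hr₁ : 0 < r₁) (hs : κ * n < s) (hsn : s < n)
    (hΥ0 : ∀ j, 0 ≤ Υ j) (hΥ : Tendsto Υ atTop (𝓝 0)) (ha : a * ((1 - κ) * n) = s - κ * n)
    (hfull : μ (limsupNbhd F fun j => Υ j ^ a)ᶜ = 0) :
    ∃ m₀, ∀ k, HasVolumeContentBound s m₀ (⋃ j ≥ k, nbhd (F j) (Υ j)) := by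
  obtain ⟨C, hC, hbound⟩ := measure_le_tsum_of_cover hF hκ1 hc₃ hc₄ hr₁ hs hsn hΥ0 hΥ ha hfull
  have hlim : Tendsto (fun m : ℕ => (√n + 1) * (1 / 2 : ℝ) ^ m) atTop (𝓝 ((√n + 1) * 0)) :=
    (tendsto_pow_atTop_nhds_zero_of_lt_one (by norm_num) (by norm_num)).const_mul _
  rw [mul_zero] at hlim
  -- From level `m₀` on, the balls around dyadic cubes are small enough for the radius conditions `r
  -- ≤ 1` and `4 * r < r₁`.
  obtain ⟨m₀, hm₀⟩ := eventually_atTop.1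
    (hlim.eventually (gt_mem_nhds (lt_min one_pos (div_pos hr₁ four_pos))))
  -- Cubes are measured by `volume` and local scaling by `μ`; uniqueness of Haar measure makes them
  -- proportional.
  set c := Measure.addHaarScalarFactor (volume : Measure (EuclideanSpace ℝ (Fin n))) μ
  have hc : (volume : Measure (EuclideanSpace ℝ (Fin n))) = c • μ :=
    Measure.isAddLeftInvariant_eq_smul _ _
  refine ⟨m₀, fun k => ⟨c * (C * ENNReal.ofReal ((√n + 1) ^ s)),
    ENNReal.mul_ne_top ENNReal.coe_ne_top (ENNReal.mul_ne_top hC ENNReal.ofReal_ne_top), ?_⟩⟩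
  intro V hV T hT hcov
  choose p hp using fun q : ℕ × (Fin n → ℤ) => nonempty_dyadicCube q
  have hradius : ∀ q : T, 0 < (√n + 1) * (1 / 2 : ℝ) ^ q.1.1 ∧
      (√n + 1) * (1 / 2 : ℝ) ^ q.1.1 ≤ 1 ∧ 4 * ((√n + 1) * (1 / 2 : ℝ) ^ q.1.1) < r₁ := by
    intro q
    have h := lt_min_iff.1 (hm₀ q.1.1 (hT q.1 q.2))
    exact ⟨by positivity, h.1.le, by linarith [h.2]⟩
  have hV' := hbound k V hV T (fun q => p q.1) (fun q => (√n + 1) * (1 / 2 : ℝ) ^ q.1.1) hradius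
    fun x hx => by
      obtain ⟨q, hq, hxq⟩ := mem_iUnion₂.1 (hcov hx)
      exact mem_iUnion.2 ⟨⟨q, hq⟩, dyadicCube_subset_ball q (hp q) hxq⟩
  have hsum : ∑' q : T, ENNReal.ofReal (((√n + 1) * (1 / 2 : ℝ) ^ q.1.1) ^ s) =
      ENNReal.ofReal ((√n + 1) ^ s) * ∑' q : T, dyadicCost s q.1 := by
    rw [← ENNReal.tsum_mul_left]
    refine tsum_congr fun q => ?_
    rw [dyadicCost, ← ENNReal.ofReal_mul (by positivity),
      Real.mul_rpow (by positivity) (by positivity)]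
  rw [hsum] at hV'
  calc volume V = c * μ V := by rw [hc]; rfl
    _ ≤ c * (C * (ENNReal.ofReal ((√n + 1) ^ s) * ∑' q : T, dyadicCost s q.1)) := by gcongr
    _ = _ := by ring

/-- A measurable set that has full measure in every ball is conull. -/
theorem measure_compl_eq_zero_of_ball {X : Type*} [MetricSpace X] [ProperSpace X]
    [MeasurableSpace X] [BorelSpace X] {μ : Measure X} [IsFiniteMeasureOnCompacts μ] {L : Set X}
    (hL : MeasurableSet L) (h : ∀ x r, 0 < r → μ (ball x r ∩ L) = μ (ball x r)) : μ Lᶜ = 0 := by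
  rcases isEmpty_or_nonempty X with hX | ⟨⟨x⟩⟩
  · rw [Set.eq_empty_of_isEmpty Lᶜ, measure_empty]
  have hcov : Lᶜ ⊆ ⋃ k : ℕ, ball x (k + 1) \ L := fun y hy => by
    obtain ⟨k, hk⟩ := exists_nat_gt (dist y x)
    exact mem_iUnion.2 ⟨k, mem_ball.2 (by linarith), hy⟩
  refine measure_mono_null hcov (measure_iUnion_null fun k => ?_)
  have h1 := measure_inter_add_sdiff (μ := μ) (ball x ((k : ℝ) + 1)) hL
  rw [h x _ (by positivity)] at h1
  by_contra h2
  exact (ENNReal.lt_add_right measure_ball_lt_top.ne h2).ne' h1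

end Assembly

theorem corollary1 (n : ℕ) (hn : 1 ≤ n) (κ : ℝ) (hκ0 : 0 ≤ κ) (hκ1 : κ < 1)
    (F : ℕ → Set (EuclideanSpace ℝ (Fin n))) (hF : LocalScaling F κ)
    (Υ : ℕ → ℝ) (hΥ0 : ∀ j, 0 ≤ Υ j) (hΥ : Filter.Tendsto Υ Filter.atTop (nhds 0))
    (s : ℝ) (hs : κ * n < s)
    (hfull : ∀ (x : EuclideanSpace ℝ (Fin n)) (r : ℝ), 0 < r →
      Measure.hausdorffMeasure (n : ℝ)
          (Metric.ball x r ∩ limsupNbhd F (fun j => Υ j ^ ((s - κ * n) / ((1 - κ) * n)))) =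
        Measure.hausdorffMeasure (n : ℝ) (Metric.ball x r)) :
    ∀ (x : EuclideanSpace ℝ (Fin n)) (r : ℝ), 0 < r →
      Measure.hausdorffMeasure s (Metric.ball x r ∩ limsupNbhd F Υ) =
        Measure.hausdorffMeasure s (Metric.ball x r) := by
  intro x r hr
  have hn0 : (0 : ℝ) < n := by exact_mod_cast hn
  have hden : (1 - κ) * n ≠ 0 := (mul_pos (sub_pos.2 hκ1) hn0).ne'
  rcases lt_trichotomy s n with hsn | rfl | hsn
  · have hs0 : 0 < s := (mul_nonneg hκ0 hn0.le).trans_lt hs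
    have := isAddHaarMeasure_hausdorffMeasure_euclideanSpace n
    obtain ⟨c₃, c₄, r₁, hc₃, hc₄, hr₁, hscale⟩ := hF
    obtain ⟨m₀, hm₀⟩ := exists_hasVolumeContentBound
      (fun j r δ h1 h2 h3 h4 => hscale r δ h1 h2 h3 h4 j) hκ1 hc₃ hc₄ hr₁ hs hsn hΥ0 hΥ
      (div_mul_cancel₀ _ hden)
      (measure_compl_eq_zero_of_ball (measurableSet_limsupNbhd _ _) hfull)
    have htop := hausdorffMeasure_ball_inter_iInter_eq_top hm₀ (isOpen_tailUnion F Υ) hs0 hsn x hr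
    rw [← limsupNbhd_eq_iInter] at htop
    rw [htop, measure_mono_top Set.inter_subset_left htop]
  · have hexp : ((n : ℝ) - κ * n) / ((1 - κ) * n) = 1 := by
      rw [div_eq_one_iff_eq hden]; ring
    simpa only [hexp, Real.rpow_one] using hfull x r hr
  · have hzero : (Measure.hausdorffMeasure s : Measure (EuclideanSpace ℝ (Fin n))) = 0 :=
      Real.hausdorffMeasure_of_finrank_lt (by rwa [finrank_euclideanSpace_fin])
    simp [hzero]
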